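/- Let $p$ be a prime and let $G$ be a finite $p$-group of maximal class, that is, $|G|=p^n$ with $n\ge 3$ and $G$ has nilpotence class $n-1$. Suppose that $|G|\ge p^6$. Then $p^4\in\operatorname{cod}(G)$, where $\operatorname{cod}(G)=\{\,|G:\ker\chi|/\chi(1) \mid \chi\in\operatorname{Irr}(G)\,\}$ is the set of codegrees of the irreducible complex characters $\chi$ of $G$. -/

import Mathlib

/-- `p`-groups of maximal class: groups of order `p ^ (c + 1)` and nilpotency class `c`,
where `c ≥ 2` (equivalently: order `p ^ n` and class `n - 1`, where `n ≥ 3`). -/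
def IsMaximalClass (p : ℕ) (G : Type*) [Group G] : Prop :=
  p.Prime ∧ ∃ c : ℕ, 2 ≤ c ∧ Nat.card G = p ^ (c + 1) ∧ Group.nilpotencyClass G = c

/-- `Irr(G)`: the set of characters of the irreducible complex representations of `G`. (Every
finite-dimensional complex representation is equivalent to one on some `ℂⁿ`.) -/
def irrCharacters (G : Type*) [Group G] : Set (G → ℂ) :=
  {χ | ∃ (n : ℕ) (ρ : Representation ℂ G (Fin n → ℂ)), ρ.IsIrreducible ∧ ρ.character = χ}

/-- The kernel of a character `χ`: the set of all `g` with `χ(g) = χ(1)`. -/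
def charKernel {G : Type*} [Group G] (χ : G → ℂ) : Set G :=
  {g | χ g = χ 1}

/-- For a finite group, the kernel of a character is the kernel of any representation that
affords it. In particular it is a normal subgroup. -/
theorem charKernel_character {G V : Type*} [Group G] [Finite G] [AddCommGroup V] [Module ℂ V]
    [FiniteDimensional ℂ V] (ρ : Representation ℂ G V) :
    charKernel ρ.character = (MonoidHom.ker ρ : Set G) := by
  ext g
  constructor
  · intro hg
    have hg' : ρ.character g = ρ.character 1 := hg
    set f : Module.End ℂ V := ρ g with hf
    have hN : 0 < orderOf g := orderOf_pos g
    have hfN : f ^ orderOf g = 1 := by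
      rw [hf, ← map_pow, pow_orderOf_eq_one, map_one]
    have hsplit : f.charpoly.Splits := IsAlgClosed.splits _
    have htr := Module.End.trace_eq_sum_roots_charpoly_of_splits hsplit
    have hcard : f.charpoly.roots.card = Module.finrank ℂ V := by
      rw [← hsplit.natDegree_eq_card_roots, LinearMap.charpoly_natDegree]
    have hroot : ∀ z ∈ f.charpoly.roots, z ^ orderOf g = 1 := by
      intro z hz
      have hz' : f.HasEigenvalue z := by
        rw [Module.End.hasEigenvalue_iff_isRoot_charpoly]
        exact Polynomial.isRoot_of_mem_roots hz
      obtain ⟨v, hv⟩ := hz'.exists_hasEigenvector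
      have h1 := hv.pow_apply (orderOf g)
      rw [hfN, Module.End.one_apply] at h1
      have h2 : (z ^ orderOf g - 1) • v = 0 := by
        rw [sub_smul, one_smul, ← h1, sub_self]
      rcases smul_eq_zero.mp h2 with h | h
      · exact sub_eq_zero.mp h
      · exact absurd h hv.2
    have hre : ∀ z ∈ f.charpoly.roots, z.re ≤ 1 := fun z hz =>
      (Complex.re_le_norm z).trans_eq
        (Complex.norm_eq_one_of_pow_eq_one (hroot z hz) hN.ne')
    have hsum : f.charpoly.roots.sum = (f.charpoly.roots.card : ℂ) := by
      rw [hcard, ← htr, ← Representation.char_one ρ, ← hg']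
      rfl
    have hone : ∀ z ∈ f.charpoly.roots, z = 1 := by
      have key : ∀ s : Multiset ℂ, (∀ z ∈ s, z.re ≤ 1) → s.sum.re ≤ s.card := by
        intro s
        induction s using Multiset.induction with
        | empty => simp
        | cons a t ih =>
          intro h
          have h1 := h a (Multiset.mem_cons_self a t)
          have h2 := ih fun z hz => h z (Multiset.mem_cons_of_mem hz)
          simp only [Multiset.sum_cons, Complex.add_re, Multiset.card_cons, Nat.cast_add,
            Nat.cast_one]
          linarith
      intro z hz
      obtain ⟨t, ht⟩ := Multiset.exists_cons_of_mem hz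
      have h1 := key t fun w hw => hre w (by rw [ht]; exact Multiset.mem_cons_of_mem hw)
      have h2 := congrArg Complex.re hsum
      rw [ht] at h2
      simp only [Multiset.sum_cons, Complex.add_re, Multiset.card_cons, Complex.natCast_re,
        Nat.cast_add, Nat.cast_one, Complex.one_re] at h2
      have h3 : z.re = 1 := le_antisymm (hre z hz) (by linarith)
      have h4 : ‖z‖ = 1 := Complex.norm_eq_one_of_pow_eq_one (hroot z hz) hN.ne'
      have h5 : z.im = 0 := by
        have h6 := Complex.sq_norm z
        rw [h4, Complex.normSq_apply, h3] at h6
        nlinarith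
      exact Complex.ext h3 h5
    have hss : f.IsSemisimple := by
      refine Module.End.isSemisimple_of_squarefree_aeval_eq_zero
        (p := Polynomial.X ^ orderOf g - 1) ?_ (by simp [hfN])
      exact ((Polynomial.X_pow_sub_one_separable_iff).mpr
        (by exact_mod_cast hN.ne')).squarefree
    have hnil : IsNilpotent (f - 1) := by
      refine ⟨f.charpoly.roots.card, ?_⟩
      have hc := hsplit.eq_prod_roots_of_monic f.charpoly_monic
      rw [Multiset.eq_replicate_of_mem hone, Multiset.map_replicate, Multiset.prod_replicate] at hc
      have h0 := f.aeval_self_charpoly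
      rw [hc] at h0
      simpa using h0
    have hss' : (f - 1).IsSemisimple := by
      have := (Module.End.isSemisimple_sub_algebraMap_iff (f := f) (μ := (1 : ℂ))).mpr hss
      simpa using this
    have h0 := Module.End.eq_zero_of_isNilpotent_isSemisimple hnil hss'
    exact MonoidHom.mem_ker.mpr (sub_eq_zero.mp h0)
  · intro hg
    have hg' : ρ g = 1 := MonoidHom.mem_ker.mp hg
    change ρ.character g = ρ.character 1
    simp only [Representation.character, hg', map_one]

/-- The codegree `|G : ker χ| / χ(1)` of a character `χ` of a finite group `G`,
where `|G : ker χ| = |G| / |ker χ|`. The division is division of complex numbers. -/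
noncomputable def codegree {G : Type*} [Group G] (χ : G → ℂ) : ℂ :=
  ((Nat.card G : ℂ) / (Nat.card (charKernel χ) : ℂ)) / χ 1

/-- `cod(G)`: the set of codegrees of the irreducible characters of `G`. -/
def codegrees (G : Type*) [Group G] : Set ℂ :=
  {d | ∃ χ ∈ irrCharacters G, codegree χ = d}

/-! Codegrees of a quotient are codegrees of `G`, since inflating a character changes neither its
degree nor the index of its kernel. For class at least 3, the quotient of a maximal class group by
its centre, which has order `p`, is again of maximal class, so induction reduces to order `p ^ 6`.

There the centre has order `p`, so some irreducible representation is faithful. Monomiality makes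
its degree a power `p ^ k`; `k ≠ 0` because `G` is not abelian, and `k ≤ 2` because the square of
the degree is less than `p ^ 6`. If `k = 2`, the codegree is `p ^ 6 / p ^ 2`. If `k = 1`, the
inducing subgroup `T` has index `p`, so it is normal, and faithfulness makes it abelian. Its image
in `G ⧸ center G`, of order `p ^ 5`, forces a faithful irreducible representation of that quotient
to have degree exactly `p`, and the codegree is `p ^ 5 / p`. -/

open Module

/-! ### Stable subspaces, Schur, Burnside and degree bounds -/

section Stable

variable {G V : Type*} [Group G] [AddCommGroup V] [Module ℂ V]

theorem isIrreducible_iff_forall_stable (ρ : Representation ℂ G V) :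
    ρ.IsIrreducible ↔ Nontrivial V ∧
      ∀ W : Submodule ℂ V, (∀ g, ∀ w ∈ W, ρ g w ∈ W) → W = ⊥ ∨ W = ⊤ := by
  constructor
  · intro h
    have hnt := h.toNontrivial
    refine ⟨?_, fun W hW => ?_⟩
    · by_contra hV
      rw [not_nontrivial_iff_subsingleton] at hV
      obtain ⟨a, b, hab⟩ := hnt
      exact hab (Subrepresentation.toSubmodule_injective (Subsingleton.elim _ _))
    · rcases h.eq_bot_or_eq_top ⟨W, fun g w hw => hW g w hw⟩ with h | h
      · exact Or.inl (congrArg Subrepresentation.toSubmodule h)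
      · exact Or.inr (congrArg Subrepresentation.toSubmodule h)
  · rintro ⟨hV, h⟩
    refine { exists_pair_ne := ⟨⊥, ⊤, fun hbt => ?_⟩, eq_bot_or_eq_top := fun W => ?_ }
    · exact bot_ne_top (α := Submodule ℂ V) (congrArg Subrepresentation.toSubmodule hbt)
    · rcases h W.toSubmodule (fun g w hw => W.apply_mem_toSubmodule g hw) with h | h
      · exact Or.inl (Subrepresentation.toSubmodule_injective h)
      · exact Or.inr (Subrepresentation.toSubmodule_injective h)

/-- A minimal nonzero stable subspace affords an irreducible representation. -/
theorem exists_irreducible_restrict (ρ : Representation ℂ G V) (W : Submodule ℂ V) (hW0 : W ≠ ⊥)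
    (hW : ∀ g, ∀ w ∈ W, ρ g w ∈ W)
    (hmin : ∀ U ≤ W, U ≠ ⊥ → (∀ g, ∀ u ∈ U, ρ g u ∈ U) → U = W) :
    ∃ σ : Representation ℂ G W, σ.IsIrreducible ∧ ∀ g w, (σ g w : V) = ρ g w := by
  let σ : Representation ℂ G W :=
    Subrepresentation.toRepresentation ⟨W, fun g w hw => hW g w hw⟩
  have hσ : ∀ g w, (σ g w : V) = ρ g w := fun _ _ => rfl
  refine ⟨σ, (isIrreducible_iff_forall_stable σ).mpr
    ⟨(Submodule.nontrivial_iff_ne_bot).mpr hW0, fun U hU => ?_⟩, hσ⟩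
  by_cases hU0 : U = ⊥
  · exact Or.inl hU0
  right
  have h := hmin (U.map W.subtype) (Submodule.map_subtype_le W U)
    (fun h => hU0 (Submodule.map_injective_of_injective W.injective_subtype (by rw [h, Submodule.map_bot]))) ?_
  · apply Submodule.map_injective_of_injective W.injective_subtype
    rw [h, Submodule.map_subtype_top]
  · rintro g _ ⟨u, hu, rfl⟩
    exact ⟨σ g u, hU g u hu, hσ g u⟩

theorem exists_minimal_stable [FiniteDimensional ℂ V] (ρ : Representation ℂ G V)
    (U : Submodule ℂ V) (hU0 : U ≠ ⊥) (hU : ∀ g, ∀ u ∈ U, ρ g u ∈ U) :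
    ∃ W ≤ U, W ≠ ⊥ ∧ (∀ g, ∀ w ∈ W, ρ g w ∈ W) ∧
      ∀ W' ≤ W, W' ≠ ⊥ → (∀ g, ∀ w ∈ W', ρ g w ∈ W') → W' = W := by
  obtain ⟨W, ⟨hWU, h0, hs⟩, hmin⟩ := WellFounded.has_min (wellFounded_lt (α := Submodule ℂ V))
    {W | W ≤ U ∧ W ≠ ⊥ ∧ ∀ g, ∀ w ∈ W, ρ g w ∈ W} ⟨U, le_rfl, hU0, hU⟩
  refine ⟨W, hWU, h0, hs, fun W' hWW hW0 hW' => ?_⟩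
  by_contra hne
  exact hmin W' ⟨hWW.trans hWU, hW0, hW'⟩ (lt_of_le_of_ne hWW hne)

/-- A minimal stable subspace is irreducible, hence a line when the group is commutative. -/
theorem exists_common_eigenvector_of_isMulCommutative [FiniteDimensional ℂ V] [Nontrivial V]
    [IsMulCommutative G] (ρ : Representation ℂ G V) :
    ∃ v : V, v ≠ 0 ∧ ∀ g, ∃ c : ℂ, ρ g v = c • v := by
  obtain ⟨W, -, h0, hs, hmin⟩ :=
    exists_minimal_stable ρ ⊤ top_ne_bot fun _ _ _ => Submodule.mem_top
  obtain ⟨σ, hσ, hσρ⟩ := exists_irreducible_restrict ρ W h0 hs hmin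
  have h1 := Representation.IsIrreducible.finrank_eq_one_of_isMulCommutative σ
  obtain ⟨w, hw0, hw⟩ := finrank_eq_one_iff'.mp h1
  refine ⟨w, fun h => hw0 (Subtype.ext h), fun g => ?_⟩
  obtain ⟨c, hc⟩ := hw (σ g w)
  exact ⟨c, by rw [← hσρ, ← hc]; rfl⟩

/-- The translates of `W` span a stable subspace, hence all of `V`, and a translate depends only on
the coset of `T`. -/
theorem finrank_le_index_mul_finrank [Finite G] [FiniteDimensional ℂ V]
    (ρ : Representation ℂ G V) (hρ : ρ.IsIrreducible) (T : Subgroup G) (W : Submodule ℂ V)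
    (hW0 : W ≠ ⊥) (hW : ∀ t ∈ T, ∀ w ∈ W, ρ t w ∈ W) :
    finrank ℂ V ≤ T.index * finrank ℂ W := by
  classical
  have : Fintype (G ⧸ T) := Fintype.ofFinite _
  let U : G ⧸ T → Submodule ℂ V := fun q => W.map (ρ q.out)
  have hmap : ∀ g : G, W.map (ρ g) ≤ U g := by
    rintro g _ ⟨w, hw, rfl⟩
    have ht : (g : G ⧸ T).out⁻¹ * g ∈ T := by
      rw [← QuotientGroup.eq, QuotientGroup.out_eq']
    refine ⟨_, hW _ ht w hw, ?_⟩
    rw [← Module.End.mul_apply, ← map_mul, mul_inv_cancel_left]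
  have htop : (⨆ g : G, W.map (ρ g)) = ⊤ := by
    refine (((isIrreducible_iff_forall_stable ρ).mp hρ).2 _ fun g w hw => ?_).resolve_left
      fun h => hW0 ?_
    · refine Submodule.iSup_induction _ (motive := fun w => ρ g w ∈ ⨆ g : G, W.map (ρ g)) hw
        ?_ (by simp) fun x y hx hy => by rw [map_add]; exact add_mem hx hy
      rintro h _ ⟨w, hw, rfl⟩
      rw [← Module.End.mul_apply, ← map_mul]
      exact Submodule.mem_iSup_of_mem (g * h) ⟨w, hw, rfl⟩
    · rw [iSup_eq_bot] at h
      simpa [Module.End.one_eq_id] using h 1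
  have hU : (⨆ q, U q) = ⊤ := by
    rw [eq_top_iff, ← htop]
    exact iSup_le fun g => (hmap g).trans (le_iSup U g)
  have hsurj : Function.Surjective (DirectSum.coeLinearMap U) := by
    rw [← LinearMap.range_eq_top, DirectSum.range_coeLinearMap, hU]
  calc finrank ℂ V ≤ finrank ℂ (DirectSum (G ⧸ T) fun q => U q) :=
        LinearMap.finrank_le_finrank_of_surjective hsurj
    _ = ∑ q, finrank ℂ (U q) := Module.finrank_directSum _ _
    _ ≤ ∑ _q : G ⧸ T, finrank ℂ W := Finset.sum_le_sum fun q _ => Submodule.finrank_map_le _ _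
    _ = T.index * finrank ℂ W := by
        rw [Finset.sum_const, Finset.card_univ, smul_eq_mul, Subgroup.index, Nat.card_eq_fintype_card]

theorem finrank_le_index_of_common_eigenvector [Finite G] [FiniteDimensional ℂ V]
    (ρ : Representation ℂ G V) (hρ : ρ.IsIrreducible) (T : Subgroup G) (v : V) (hv : v ≠ 0)
    (hT : ∀ t ∈ T, ∃ c : ℂ, ρ t v = c • v) : finrank ℂ V ≤ T.index := by
  have h := finrank_le_index_mul_finrank ρ hρ T (ℂ ∙ v) (by simpa using hv) ?_
  · rwa [finrank_span_singleton hv, mul_one] at h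
  · intro t ht w hw
    obtain ⟨a, rfl⟩ := Submodule.mem_span_singleton.mp hw
    obtain ⟨c, hc⟩ := hT t ht
    rw [map_smul, hc]
    exact Submodule.smul_mem _ _ (Submodule.smul_mem _ _ (Submodule.mem_span_singleton_self v))

theorem finrank_le_index_of_isMulCommutative [Finite G] [FiniteDimensional ℂ V]
    (ρ : Representation ℂ G V) (hρ : ρ.IsIrreducible) (A : Subgroup G) [IsMulCommutative A] :
    finrank ℂ V ≤ A.index := by
  have := ((isIrreducible_iff_forall_stable ρ).mp hρ).1
  obtain ⟨v, hv, h⟩ := exists_common_eigenvector_of_isMulCommutative (ρ.comp A.subtype)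
  exact finrank_le_index_of_common_eigenvector ρ hρ A v hv fun t ht => h ⟨t, ht⟩

/-- **Burnside's theorem**: the operators of an irreducible representation span all operators. -/
theorem span_range_eq_top_of_isIrreducible [FiniteDimensional ℂ V] (ρ : Representation ℂ G V)
    (hρ : ρ.IsIrreducible) : Submodule.span ℂ (Set.range ρ) = ⊤ := by
  have hs : IsSimpleModule (MonoidAlgebra ℂ G) ρ.asModule :=
    (Representation.irreducible_iff_isSimpleModule_asModule ρ).mp hρ
  rw [eq_top_iff]
  intro f _
  -- By Schur's lemma the module endomorphisms are scalars, so every linear `f` commutes with them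
  -- and the density theorem applies to it.
  let f' : Module.End (Module.End (MonoidAlgebra ℂ G) ρ.asModule) ρ.asModule :=
    { toFun := f
      map_add' := map_add f
      map_smul' := fun e x => by
        obtain ⟨c, rfl⟩ := (IsSimpleModule.algebraMap_end_bijective_of_isAlgClosed ℂ
          (A := MonoidAlgebra ℂ G) (V := ρ.asModule)).2 e
        exact map_smul f c x }
  let b := Module.finBasis ℂ V
  classical
  obtain ⟨r, hr⟩ := jacobson_density f' (Finset.univ.image b)
  have hfr : f = ρ.asAlgebraHom r := by
    refine b.ext fun i => ?_
    exact hr (b i) (Finset.mem_image_of_mem _ (Finset.mem_univ i))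
  rw [hfr]
  clear hr hfr
  induction r using MonoidAlgebra.induction_linear with
  | zero => simp
  | add x y hx hy => rw [map_add]; exact add_mem hx hy
  | single g c =>
    rw [Representation.asAlgebraHom_single]
    exact Submodule.smul_mem _ _ (Submodule.subset_span ⟨g, rfl⟩)

/-- **Schur's lemma**. -/
theorem exists_eq_smul_one_of_commute [FiniteDimensional ℂ V] (ρ : Representation ℂ G V)
    (hρ : ρ.IsIrreducible) (f : Module.End ℂ V) (hf : ∀ g, ρ g * f = f * ρ g) :
    ∃ c : ℂ, f = c • 1 := by
  obtain ⟨hV, h⟩ := (isIrreducible_iff_forall_stable ρ).mp hρ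
  obtain ⟨c, hc⟩ := Module.End.exists_eigenvalue f
  refine ⟨c, LinearMap.ext fun v => ?_⟩
  have htop := (h (f.eigenspace c) fun g w hw => ?_).resolve_left hc
  · have hv : v ∈ f.eigenspace c := htop ▸ Submodule.mem_top
    simpa using Module.End.mem_eigenspace_iff.mp hv
  · rw [Module.End.mem_eigenspace_iff] at hw ⊢
    rw [← Module.End.mul_apply, ← hf, Module.End.mul_apply, hw, map_smul]

/-- By Burnside's theorem the operators `ρ g` span a space of dimension `finrank ℂ V ^ 2`. Equality
would make them linearly independent, but `ρ z` is a scalar multiple of `ρ 1`. -/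
theorem finrank_sq_lt_card [Finite G] [FiniteDimensional ℂ V] (ρ : Representation ℂ G V)
    (hρ : ρ.IsIrreducible) (z : G) (hz1 : z ≠ 1) (hz : z ∈ Subgroup.center G) :
    finrank ℂ V ^ 2 < Nat.card G := by
  have := Fintype.ofFinite G
  have hspan := span_range_eq_top_of_isIrreducible ρ hρ
  have hfin : finrank ℂ (Module.End ℂ V) = finrank ℂ V ^ 2 := by
    rw [Module.finrank_linearMap, sq]
  have hle := finrank_range_le_card (R := ℂ) (b := ρ)
  rw [Set.finrank, hspan, finrank_top, hfin, ← Nat.card_eq_fintype_card] at hle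
  refine lt_of_le_of_ne hle fun heq => ?_
  have hli := linearIndependent_of_top_le_span_of_card_eq_finrank (b := ρ) hspan.ge
    (by rw [hfin, heq, Nat.card_eq_fintype_card])
  obtain ⟨c, hc⟩ := exists_eq_smul_one_of_commute ρ hρ (ρ z) fun g => by
    rw [← map_mul, ← map_mul, Subgroup.mem_center_iff.mp hz g]
  have h := hli (a₁ := Finsupp.single z 1) (a₂ := Finsupp.single 1 c) (by simp [hc])
  simpa [Finsupp.single_apply, hz1.symm] using DFunLike.congr_fun h z

/-- If `ρ x` commutes with every `ρ g` up to a scalar and `T` contains the centralizer of `ρ x`, then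
the translates of an eigenspace of `ρ x` by representatives of `G ⧸ T` are independent. -/
theorem index_mul_finrank_eigenspace_le [Finite G] [FiniteDimensional ℂ V]
    (ρ : Representation ℂ G V) (T : Subgroup G) (x : G) (c : G → ℂ)
    (hc : ∀ g, ρ x * ρ g = c g • (ρ g * ρ x))
    (hT : ∀ g, ρ g * ρ x = ρ x * ρ g → g ∈ T) (μ : ℂ)
    (hμ : Module.End.HasEigenvalue (ρ x) μ) :
    T.index * finrank ℂ (Module.End.eigenspace (ρ x) μ) ≤ finrank ℂ V := by
  classical
  have : Fintype (G ⧸ T) := Fintype.ofFinite _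
  have hinj : ∀ g, Function.Injective (ρ g) := fun g => (ρ.apply_bijective g).1
  have hμ0 : μ ≠ 0 := by
    rintro rfl
    obtain ⟨v, hv⟩ := hμ.exists_hasEigenvector
    have h1 := hv.apply_eq_smul
    rw [zero_smul] at h1
    exact hv.2 (hinj x (by rw [h1, map_zero]))
  have hnt : Nontrivial V := by
    obtain ⟨v, hv⟩ := hμ.exists_hasEigenvector
    exact ⟨v, 0, hv.2⟩
  have hunit : ∀ g, ρ g * ρ g⁻¹ = 1 := fun g => by rw [← map_mul, mul_inv_cancel, map_one]
  have hunit' : ∀ g, ρ g⁻¹ * ρ g = 1 := fun g => by rw [← map_mul, inv_mul_cancel, map_one]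
  have hc0 : ∀ g, c g ≠ 0 := by
    intro g h0
    have h := hc g
    rw [h0, zero_smul, ← map_mul] at h
    have h2 := hunit (x * g)
    rw [h, zero_mul] at h2
    exact zero_ne_one h2
  let ν : G ⧸ T → ℂ := fun q => c q.out * μ
  -- If `g` and `h` give the same scalar, `ρ (g⁻¹ * h)` commutes with `ρ x`, so `g` and `h` lie in
  -- one coset of `T`.
  have hν : Function.Injective ν := by
    intro q r hqr
    have hcc : c q.out = c r.out := mul_right_cancel₀ hμ0 hqr
    rw [← QuotientGroup.out_eq' q, ← QuotientGroup.out_eq' r, QuotientGroup.eq]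
    apply hT
    generalize q.out = g at *
    generalize r.out = h at *
    have h1 : c g • (ρ g * (ρ x * ρ (g⁻¹ * h))) = c g • (ρ g * (ρ (g⁻¹ * h) * ρ x)) := by
      rw [← mul_assoc, ← smul_mul_assoc, ← hc, mul_assoc, ← map_mul ρ g, mul_inv_cancel_left, hc,
        ← mul_assoc, ← map_mul ρ g, mul_inv_cancel_left, hcc]
    have h2 := smul_right_injective _ (hc0 g) h1
    have h3 := congrArg (ρ g⁻¹ * ·) h2
    simp only [← mul_assoc, hunit', one_mul] at h3
    exact h3.symm
  have hind : iSupIndep fun q => Module.End.eigenspace (ρ x) (ν q) :=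
    (Module.End.eigenspaces_iSupIndep (ρ x)).comp hν
  -- `ρ g` carries the `μ`-eigenspace of `ρ x` into the eigenspace for `c g * μ`.
  have hle : ∀ q, finrank ℂ (Module.End.eigenspace (ρ x) μ) ≤ finrank ℂ (Module.End.eigenspace (ρ x) (ν q)) := by
    intro q
    rw [LinearEquiv.finrank_eq (Submodule.equivMapOfInjective (ρ q.out) (hinj _) _)]
    apply Submodule.finrank_mono
    rintro _ ⟨w, hw, rfl⟩
    have hw' : ρ x w = μ • w := Module.End.mem_eigenspace_iff.mp hw
    rw [Module.End.mem_eigenspace_iff, ← Module.End.mul_apply, hc, LinearMap.smul_apply,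
      Module.End.mul_apply, hw', map_smul, smul_smul]
  calc T.index * finrank ℂ (Module.End.eigenspace (ρ x) μ)
      = ∑ _q : G ⧸ T, finrank ℂ (Module.End.eigenspace (ρ x) μ) := by
        rw [Finset.sum_const, Finset.card_univ, smul_eq_mul, Subgroup.index, Nat.card_eq_fintype_card]
    _ ≤ ∑ q, finrank ℂ (Module.End.eigenspace (ρ x) (ν q)) := Finset.sum_le_sum fun q _ => hle q
    _ = finrank ℂ (DirectSum (G ⧸ T) fun q => Module.End.eigenspace (ρ x) (ν q)) :=
        (Module.finrank_directSum _ _).symm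
    _ ≤ finrank ℂ V := LinearMap.finrank_le_finrank_of_injective
        (f := DirectSum.coeLinearMap fun q => Module.End.eigenspace (ρ x) (ν q))
          hind.dfinsupp_lsum_injective

/-- The elements of `G` acting by operators that commute with the representation; for an irreducible
representation these are the elements acting by scalars. -/
def scalarSubgroup (ρ : Representation ℂ G V) : Subgroup G where
  carrier := {g | ∀ h, ρ g * ρ h = ρ h * ρ g}
  one_mem' h := by simp
  mul_mem' {a b} ha hb h := by rw [map_mul, mul_assoc, hb, ← mul_assoc, ha, mul_assoc]
  inv_mem' {a} ha h := by
    have h1 : ρ a⁻¹ * ρ a = 1 := by rw [← map_mul, inv_mul_cancel, map_one]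
    have h2 : ρ a * ρ a⁻¹ = 1 := by rw [← map_mul, mul_inv_cancel, map_one]
    calc ρ a⁻¹ * ρ h = ρ a⁻¹ * (ρ h * ρ a) * ρ a⁻¹ := by rw [mul_assoc, mul_assoc, h2, mul_one]
      _ = ρ h * ρ a⁻¹ := by rw [← ha h, ← mul_assoc, h1, one_mul]

instance scalarSubgroup_normal (ρ : Representation ℂ G V) : (scalarSubgroup ρ).Normal where
  conj_mem n hn g := by
    have h1 : ρ (g * n * g⁻¹) = ρ n := by
      rw [map_mul, map_mul, ← hn g, mul_assoc, ← map_mul, mul_inv_cancel, map_one, mul_one]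
    intro h
    rw [h1, hn h]

theorem exists_eq_smul_one_of_mem_scalarSubgroup [FiniteDimensional ℂ V]
    (ρ : Representation ℂ G V) (hρ : ρ.IsIrreducible) {g : G} (hg : g ∈ scalarSubgroup ρ) :
    ∃ c : ℂ, ρ g = c • 1 :=
  exists_eq_smul_one_of_commute ρ hρ (ρ g) fun h => (hg h).symm

end Stable

/-- Irreducible representations of finite `p`-groups are monomial. -/
theorem exists_common_eigenvector_finrank_eq_index {p : ℕ} [Fact p.Prime] {G V : Type*} [Group G]
    [Finite G] (hG : IsPGroup p G) [AddCommGroup V] [Module ℂ V] [FiniteDimensional ℂ V]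
    (ρ : Representation ℂ G V) (hρ : ρ.IsIrreducible) :
    ∃ (T : Subgroup G) (v : V), v ≠ 0 ∧ (∀ t ∈ T, ∃ c : ℂ, ρ t v = c • v) ∧
      finrank ℂ V = T.index := by
  induction hn : Nat.card G using Nat.strong_induction_on generalizing G V with
  | _ n ih =>
  subst hn
  obtain ⟨hV, hirr⟩ := (isIrreducible_iff_forall_stable ρ).mp hρ
  by_cases hS : scalarSubgroup ρ = ⊤
  · obtain ⟨v, hv⟩ := exists_ne (0 : V)
    have hsc : ∀ g, ∃ c : ℂ, ρ g v = c • v := fun g => by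
      obtain ⟨c, hc⟩ := exists_eq_smul_one_of_mem_scalarSubgroup ρ hρ (hS ▸ Subgroup.mem_top g)
      exact ⟨c, by rw [hc]; rfl⟩
    refine ⟨⊤, v, hv, fun t _ => hsc t, le_antisymm ?_ ?_⟩
    · exact finrank_le_index_of_common_eigenvector ρ hρ ⊤ v hv fun t _ => hsc t
    · rw [Subgroup.index_top]; exact Module.finrank_pos
  -- Choose `x` nontrivial and central modulo the scalar subgroup: its commutators act by scalars,
  -- and the centralizer `T` of `ρ x` is proper.
  have hnt : Nontrivial (G ⧸ scalarSubgroup ρ) := QuotientGroup.nontrivial_iff.mpr hS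
  have hctr : Nontrivial (Subgroup.center (G ⧸ scalarSubgroup ρ)) :=
    (hG.to_quotient (scalarSubgroup ρ)).center_nontrivial
  obtain ⟨⟨y, hyc⟩, hy1⟩ := exists_ne (1 : Subgroup.center (G ⧸ scalarSubgroup ρ))
  obtain ⟨x, rfl⟩ := QuotientGroup.mk_surjective y
  have hxS : x ∉ scalarSubgroup ρ := fun h =>
    hy1 (Subtype.ext ((QuotientGroup.eq_one_iff x).mpr h))
  have hc : ∀ g, ∃ c : ℂ, ρ x * ρ g = c • (ρ g * ρ x) := by
    intro g
    have h1 : (g * x)⁻¹ * (x * g) ∈ scalarSubgroup ρ := by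
      rw [← QuotientGroup.eq]
      exact Subgroup.mem_center_iff.mp hyc g
    obtain ⟨c, hc⟩ := exists_eq_smul_one_of_mem_scalarSubgroup ρ hρ h1
    refine ⟨c, ?_⟩
    rw [← map_mul, ← map_mul, ← mul_inv_cancel_left (g * x) (x * g), map_mul, hc, mul_smul_comm,
      mul_one]
  choose c hc using hc
  let T : Subgroup G :=
    { carrier := {g | ρ g * ρ x = ρ x * ρ g}
      one_mem' := by simp
      mul_mem' := fun {a b} ha hb => by
        change ρ (a * b) * ρ x = ρ x * ρ (a * b)
        rw [map_mul, mul_assoc, show ρ b * ρ x = _ from hb, ← mul_assoc,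
          show ρ a * ρ x = _ from ha, mul_assoc]
      inv_mem' := fun {a} ha => by
        have h1 : ρ a⁻¹ * ρ a = 1 := by rw [← map_mul, inv_mul_cancel, map_one]
        have h2 : ρ a * ρ a⁻¹ = 1 := by rw [← map_mul, mul_inv_cancel, map_one]
        calc ρ a⁻¹ * ρ x = ρ a⁻¹ * (ρ x * ρ a) * ρ a⁻¹ := by
              rw [mul_assoc, mul_assoc, h2, mul_one]
          _ = ρ x * ρ a⁻¹ := by
              rw [← show ρ a * ρ x = _ from ha, ← mul_assoc, h1, one_mul] }
  have hT : ∀ g, g ∈ T ↔ ρ g * ρ x = ρ x * ρ g := fun g => Iff.rfl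
  have hTtop : T ≠ ⊤ := fun h => hxS fun g => ((hT g).mp (h ▸ Subgroup.mem_top g)).symm
  obtain ⟨μ, hμ⟩ := Module.End.exists_eigenvalue (ρ x)
  have hle := index_mul_finrank_eigenspace_le ρ T x c hc (fun g hg => hg) μ hμ
  set E := Module.End.eigenspace (ρ x) μ with hE
  have hEstable : ∀ t ∈ T, ∀ w ∈ E, ρ t w ∈ E := by
    intro t ht w hw
    rw [hE, Module.End.mem_eigenspace_iff] at hw ⊢
    rw [← Module.End.mul_apply, ← (hT t).mp ht, Module.End.mul_apply, hw, map_smul]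
  have hidx : T.index ≠ 0 := Subgroup.index_ne_zero_of_finite
  -- A nonzero `T`-stable `U ≤ E` satisfies `T.index * finrank E ≤ finrank V ≤ T.index * finrank U`,
  -- so `U = E`: the eigenspace is irreducible under `T`, and induction applies to it.
  obtain ⟨σ, hσ, hσρ⟩ := exists_irreducible_restrict (ρ.comp T.subtype) E hμ
    (fun t w hw => hEstable t t.2 w hw) fun U hUE hU0 hU => by
      refine Submodule.eq_of_le_of_finrank_le hUE ?_
      have h := finrank_le_index_mul_finrank ρ hρ T U hU0 fun t ht u hu => hU ⟨t, ht⟩ u hu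
      exact Nat.le_of_mul_le_mul_left (hle.trans h) (Nat.pos_of_ne_zero hidx)
  obtain ⟨T', v, hv, hTv, hfr⟩ := ih (Nat.card T)
    (lt_of_le_of_ne (Subgroup.card_le_card_group T) fun h => hTtop (Subgroup.eq_top_of_card_eq T h))
    (hG.to_subgroup T) σ hσ rfl
  refine ⟨T'.map T.subtype, v, fun h => hv (Subtype.ext h), ?_, ?_⟩
  · rintro _ ⟨t, ht, rfl⟩
    obtain ⟨a, ha⟩ := hTv t ht
    exact ⟨a, by rw [show ρ (T.subtype t) v = _ from (hσρ t v).symm, ha]; rfl⟩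
  · rw [Subgroup.index_map_subtype, ← hfr, mul_comm]
    exact le_antisymm (finrank_le_index_mul_finrank ρ hρ T E hμ hEstable) hle

open Subgroup

/-- A nontrivial normal subgroup of a finite `p`-group contains a nontrivial central element. -/
theorem IsPGroup.exists_mem_center_of_normal {p : ℕ} [Fact p.Prime] {G : Type*} [Group G]
    [Finite G] (hG : IsPGroup p G) (N : Subgroup G) [N.Normal] (hN : N ≠ ⊥) :
    ∃ b ∈ N, b ≠ 1 ∧ b ∈ center G := by
  have hnt : Nontrivial N := (nontrivial_iff_ne_bot N).mpr hN
  have hdvd : p ∣ Nat.card N := by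
    obtain ⟨k, hk, hk'⟩ := (hG.to_subgroup N).nontrivial_iff_card.mp hnt
    exact hk' ▸ dvd_pow_self p hk.ne'
  -- Under conjugation, `1` is a fixed point of `N`; as `p` divides the order of `N`, there is
  -- another.
  obtain ⟨b, hb, hb1⟩ :=
    (hG.of_equiv ConjAct.toConjAct).exists_fixed_point_of_prime_dvd_card_of_fixed_point N hdvd
      (a := 1) (fun g => smul_one g)
  refine ⟨b, b.2, fun h => hb1 (Subtype.ext h.symm), mem_center_iff.mpr fun g => ?_⟩
  have h := congrArg Subtype.val (hb (ConjAct.toConjAct g))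
  rw [ConjAct.Subgroup.val_conj_smul, ConjAct.toConjAct_smul] at h
  exact mul_inv_eq_iff_eq_mul.mp h

/-! ### Codegrees, inflation and faithful irreducible representations -/

section Codegrees

variable {G V : Type*} [Group G] [AddCommGroup V] [Module ℂ V]

/-- Transport to coordinates, needed because `irrCharacters` admits only representations on `ℂⁿ`. -/
theorem exists_equiv_fin_fun [FiniteDimensional ℂ V] (ρ : Representation ℂ G V)
    (hρ : ρ.IsIrreducible) :
    ∃ σ : Representation ℂ G (Fin (finrank ℂ V) → ℂ), σ.IsIrreducible ∧
      MonoidHom.ker σ = MonoidHom.ker ρ := by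
  obtain ⟨hV, h⟩ := (isIrreducible_iff_forall_stable ρ).mp hρ
  let e : V ≃ₗ[ℂ] (Fin (finrank ℂ V) → ℂ) := (finBasis ℂ V).equivFun
  let σ : Representation ℂ G (Fin (finrank ℂ V) → ℂ) :=
    (e.conjRingEquiv : End ℂ V →* End ℂ (Fin (finrank ℂ V) → ℂ)).comp ρ
  have hσ : ∀ g v, σ g (e v) = e (ρ g v) := fun g v => by
    change e (ρ g (e.symm (e v))) = _
    rw [e.symm_apply_apply]
  refine ⟨σ, (isIrreducible_iff_forall_stable σ).mpr ⟨e.symm.toEquiv.nontrivial, ?_⟩, ?_⟩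
  · intro W hW
    rcases h (W.comap e.toLinearMap) (fun g w hw => by
      have := hW g (e w) hw
      rw [hσ] at this
      exact this) with h | h
    · left
      rw [eq_bot_iff]
      intro w hw
      have : e.symm w ∈ W.comap e.toLinearMap := by simpa using hw
      rw [h, Submodule.mem_bot] at this
      simpa using this
    · right
      rw [eq_top_iff]
      intro w _
      have : e.symm w ∈ W.comap e.toLinearMap := h ▸ Submodule.mem_top
      simpa using this
  · ext g
    rw [MonoidHom.mem_ker, MonoidHom.mem_ker]
    exact map_eq_one_iff (e.conjRingEquiv) e.conjRingEquiv.injective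

theorem codegree_character [Finite G] [FiniteDimensional ℂ V] (ρ : Representation ℂ G V) :
    codegree ρ.character = ((MonoidHom.ker ρ).index : ℂ) / finrank ℂ V := by
  have h : (Nat.card (MonoidHom.ker ρ) : ℂ) ≠ 0 := Nat.cast_ne_zero.mpr Nat.card_pos.ne'
  rw [codegree, charKernel_character, Representation.char_one,
    ← (MonoidHom.ker ρ).card_mul_index, Nat.cast_mul]
  congr 1
  exact mul_div_cancel_left₀ _ h

theorem card_div_finrank_mem_codegrees [Finite G] [FiniteDimensional ℂ V]
    (ρ : Representation ℂ G V) (hρ : ρ.IsIrreducible) (hker : MonoidHom.ker ρ = ⊥) :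
    (Nat.card G : ℂ) / finrank ℂ V ∈ codegrees G := by
  obtain ⟨σ, hσ, hk⟩ := exists_equiv_fin_fun ρ hρ
  refine ⟨σ.character, ⟨_, σ, hσ, rfl⟩, ?_⟩
  rw [codegree_character, hk, hker, Subgroup.index_bot, finrank_fin_fun]

theorem codegrees_subset_of_surjective {H : Type*} [Group H] [Finite G] (f : G →* H)
    (hf : Function.Surjective f) : codegrees H ⊆ codegrees G := by
  have : Finite H := Finite.of_surjective f hf
  rintro _ ⟨_, ⟨n, ρ, hρ, rfl⟩, rfl⟩
  refine ⟨_, ⟨n, ρ.comp f, ?_, rfl⟩, ?_⟩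
  · rw [isIrreducible_iff_forall_stable] at hρ ⊢
    refine ⟨hρ.1, fun W hW => hρ.2 W fun h w hw => ?_⟩
    obtain ⟨g, rfl⟩ := hf h
    exact hW g w hw
  · rw [codegree_character, codegree_character,
      show MonoidHom.ker (ρ.comp f) = (MonoidHom.ker ρ).comap f from rfl,
      Subgroup.index_comap_of_surjective _ hf]

/-- Over `ℂ`, a nontrivial central element acts nontrivially in some irreducible representation. -/
theorem exists_irreducible_apply_ne_one [Finite G] (z : G) (hz1 : z ≠ 1)
    (hz : z ∈ Subgroup.center G) :
    ∃ (n : ℕ) (σ : Representation ℂ G (Fin n → ℂ)), σ.IsIrreducible ∧ σ z ≠ 1 := by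
  let ρ := Representation.leftRegular ℂ G
  have hcomm : ∀ g v, ρ g (ρ z v) = ρ z (ρ g v) := fun g v => by
    rw [← End.mul_apply, ← End.mul_apply, ← map_mul, ← map_mul, Subgroup.mem_center_iff.mp hz g]
  have : FiniteDimensional ℂ (MonoidAlgebra ℂ G) :=
    Module.Finite.equiv (MonoidAlgebra.coeffLinearEquiv ℂ).symm
  -- If `z` fixed every `u = ρ z w - w` in `W`, then `ρ (z ^ k) w = w + k • u`; taking `k = orderOf
  -- z` gives `u = 0`.
  obtain ⟨W, hWU, h0, hs, hmin⟩ := exists_minimal_stable ρ (LinearMap.range (ρ z - 1))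
    (by
      intro h
      have h1 := LinearMap.congr_fun (LinearMap.range_eq_bot.mp h) (MonoidAlgebra.single 1 1)
      rw [LinearMap.sub_apply, LinearMap.zero_apply, End.one_apply, sub_eq_zero,
        Representation.ofMulAction_single, smul_eq_mul, mul_one] at h1
      exact hz1 (MonoidAlgebra.single_left_injective one_ne_zero h1))
    (by
      rintro g _ ⟨v, rfl⟩
      exact ⟨ρ g v, by simp [hcomm]⟩)
  obtain ⟨σ, hσ, hσρ⟩ := exists_irreducible_restrict ρ W h0 hs hmin
  obtain ⟨τ, hτ, hk⟩ := exists_equiv_fin_fun σ hσ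
  refine ⟨_, τ, hτ, fun h => h0 ?_⟩
  have hz' : σ z = 1 := by
    rw [← MonoidHom.mem_ker, ← hk]; exact MonoidHom.mem_ker.mpr h
  rw [eq_bot_iff]
  intro u hu
  obtain ⟨w, hw⟩ := hWU hu
  have hfix : ρ z u = u := by
    have := hσρ z ⟨u, hu⟩
    rw [hz'] at this
    exact this.symm
  have hw' : ρ z w = w + u := by rw [← hw]; simp
  have hpow : ∀ k : ℕ, ρ (z ^ k) w = w + k • u := by
    intro k
    induction k with
    | zero => simp
    | succ k ih =>
      rw [pow_succ', map_mul, End.mul_apply, ih, map_add, map_nsmul, hw', hfix, succ_nsmul]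
      abel
  have h1 := hpow (orderOf z)
  rw [pow_orderOf_eq_one, map_one, End.one_apply, left_eq_add, ← Nat.cast_smul_eq_nsmul ℂ,
    smul_eq_zero, Nat.cast_eq_zero] at h1
  exact h1.resolve_left (orderOf_pos z).ne'

/-- A nontrivial kernel would contain a nontrivial central element, hence the whole centre, which
has prime order; but some central `z` acts nontrivially. -/
theorem exists_faithful_irreducible {p : ℕ} [Fact p.Prime] [Finite G] (hG : IsPGroup p G)
    (hZ : Nat.card (Subgroup.center G) = p) :
    ∃ (n : ℕ) (σ : Representation ℂ G (Fin n → ℂ)), σ.IsIrreducible ∧ MonoidHom.ker σ = ⊥ := by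
  have : Nontrivial (Subgroup.center G) := by
    rw [← Finite.one_lt_card_iff_nontrivial, hZ]; exact (Fact.out : p.Prime).one_lt
  obtain ⟨⟨z, hz⟩, hz1⟩ := exists_ne (1 : Subgroup.center G)
  obtain ⟨n, σ, hσ, hσz⟩ := exists_irreducible_apply_ne_one z (fun h => hz1 (Subtype.ext h)) hz
  refine ⟨n, σ, hσ, ?_⟩
  by_contra hne
  obtain ⟨b, hb, hb1, hbZ⟩ := hG.exists_mem_center_of_normal (MonoidHom.ker σ) hne
  have : Fact (Nat.card (center G)).Prime := ⟨hZ ▸ Fact.out⟩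
  have hzb : (⟨z, hz⟩ : center G) ∈ zpowers (⟨b, hbZ⟩ : center G) :=
    mem_zpowers_of_prime_card (p := p) hZ fun h => hb1 (congrArg Subtype.val h)
  obtain ⟨k, hk⟩ := mem_zpowers_iff.mp hzb
  have hk' : b ^ k = z := congrArg Subtype.val hk
  exact hσz (MonoidHom.mem_ker.mp (hk' ▸ zpow_mem hb k))

/-- In a faithful irreducible representation, a normal subgroup all of whose elements have a common
eigenvector is commutative. -/
theorem commute_of_normal_of_common_eigenvector (ρ : Representation ℂ G V)
    (hρ : ρ.IsIrreducible) (hker : MonoidHom.ker ρ = ⊥) (T : Subgroup G) [T.Normal] (v : V)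
    (hv : v ≠ 0) (hT : ∀ t ∈ T, ∃ c : ℂ, ρ t v = c • v) {s t : G} (hs : s ∈ T) (ht : t ∈ T) :
    s * t = t * s := by
  have hcomm : ∀ a ∈ T, ∀ b ∈ T, ρ (a * b) v = ρ (b * a) v := by
    intro a ha b hb
    obtain ⟨c, hc⟩ := hT a ha
    obtain ⟨d, hd⟩ := hT b hb
    rw [map_mul, map_mul, End.mul_apply, End.mul_apply, hd, map_smul, hc, map_smul, hd, smul_comm]
  have hspan : Submodule.span ℂ (Set.range fun g => ρ g v) = ⊤ := by
    refine (((isIrreducible_iff_forall_stable ρ).mp hρ).2 _ fun g w hw => ?_).resolve_left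
      fun h => hv ?_
    · induction hw using Submodule.span_induction with
      | mem x hx =>
        obtain ⟨h, rfl⟩ := hx
        refine Submodule.subset_span ⟨g * h, ?_⟩
        simp [map_mul]
      | zero => simp
      | add x y _ _ hx hy => rw [map_add]; exact add_mem hx hy
      | smul a x _ hx => rw [map_smul]; exact Submodule.smul_mem _ _ hx
    · have h1 : ρ 1 v ∈ Submodule.span ℂ (Set.range fun g => ρ g v) :=
        Submodule.subset_span ⟨1, rfl⟩
      rw [h, Submodule.mem_bot] at h1
      simpa using h1
  -- The vectors `ρ g v` span `V`. On each of them the claim reduces to the conjugates of `s` and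
  -- `t` by `g⁻¹`, which lie in `T` and commute on `v`.
  have heq : ρ (s * t) = ρ (t * s) := by
    refine LinearMap.ext_on_range hspan fun g => ?_
    have hn : ∀ a ∈ T, g⁻¹ * a * g ∈ T := fun a ha => by
      simpa using Subgroup.Normal.conj_mem ‹T.Normal› a ha g⁻¹
    have h := congrArg (ρ g) (hcomm _ (hn s hs) _ (hn t ht))
    simp only [← End.mul_apply, ← map_mul] at h ⊢
    convert h using 3 <;> group
  have hinj : Function.Injective ρ := (MonoidHom.ker_eq_bot_iff ρ).mp hker
  exact hinj heq

end Codegrees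

/-! ### Groups of maximal class -/

section MaximalClass

/-- Each central quotient lowers the class by one and the order by a factor of at least `p`. The
extra factor comes from class 2, where `G ⧸ center G` is not cyclic and so has order at least `p ^
2`. -/
theorem pow_nilpotencyClass_succ_le_card {p : ℕ} [Fact p.Prime] {G : Type*} [Group G] [Finite G]
    (hG : IsPGroup p G) (hc : 2 ≤ Group.nilpotencyClass G) :
    p ^ (Group.nilpotencyClass G + 1) ≤ Nat.card G := by
  have hp : p.Prime := Fact.out
  induction hn : Group.nilpotencyClass G using Nat.strong_induction_on generalizing G with
  | _ n ih =>
  subst hn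
  have hnil := hG.isNilpotent
  have hQ : IsPGroup p (G ⧸ center G) := hG.to_quotient _
  have hQc := Group.nilpotencyClass_quotient_center (G := G)
  have hnt : Nontrivial G := by
    by_contra h
    rw [not_nontrivial_iff_subsingleton] at h
    have := Group.nilpotencyClass_zero_iff_subsingleton.mpr h
    omega
  have hZ : p ≤ Nat.card (center G) := by
    have := hG.center_nontrivial
    obtain ⟨k, hk, hk'⟩ := (hG.to_subgroup (center G)).nontrivial_iff_card.mp this
    rw [hk']
    exact Nat.le_self_pow hk.ne' p
  have hQcard : p ^ Group.nilpotencyClass G ≤ Nat.card (G ⧸ center G) := by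
    by_cases h2 : Group.nilpotencyClass G = 2
    · obtain ⟨k, hk⟩ := IsPGroup.iff_card.mp hQ
      rw [h2, hk]
      refine Nat.pow_le_pow_right hp.pos ?_
      by_contra hlt
      have hcyc : IsCyclic (G ⧸ center G) := isCyclic_of_card_dvd_prime (p := p) (by
        rw [hk]; exact (pow_dvd_pow p (by omega)).trans (pow_one p).dvd)
      have := isMulCommutative_of_isCyclic_quotient_center_self G
      have := Group.IsNilpotent.nilpotencyClass_le_one_iff.mpr this
      omega
    · have := ih _ (by omega) hQ (by omega) rfl
      rwa [hQc, Nat.sub_add_cancel (by omega)] at this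
  calc p ^ (Group.nilpotencyClass G + 1) = p * p ^ Group.nilpotencyClass G := pow_succ' _ _
    _ ≤ Nat.card (center G) * Nat.card (G ⧸ center G) := Nat.mul_le_mul hZ hQcard
    _ = Nat.card G := (center G).card_mul_index

namespace IsMaximalClass

theorem isPGroup {p : ℕ} {G : Type*} [Group G] (hG : IsMaximalClass p G) : IsPGroup p G := by
  obtain ⟨_, c, _, h, _⟩ := hG
  exact IsPGroup.of_card h

variable {p : ℕ} {G : Type*} [Group G] [Finite G]

theorem not_isMulCommutative (hG : IsMaximalClass p G) : ¬ IsMulCommutative G := by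
  have := Fact.mk hG.1
  have := hG.isPGroup.isNilpotent
  obtain ⟨_, c, hc, _, h⟩ := hG
  rw [← Group.IsNilpotent.nilpotencyClass_le_one_iff]
  omega

/-- The lower bounds `p` for the centre and `p ^ c` for the quotient multiply to the order of `G`,
so both are attained. The bound `3 ≤ c` keeps the class of the quotient at least 2. -/
theorem card_center_and_card_quotient {c : ℕ} (hG : IsMaximalClass p G) (hc : 3 ≤ c)
    (hcard : Nat.card G = p ^ (c + 1)) :
    Nat.card (center G) = p ∧ Nat.card (G ⧸ center G) = p ^ c ∧
      IsMaximalClass p (G ⧸ center G) := by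
  have hPG := hG.isPGroup
  have hp := hG.1
  have := Fact.mk hp
  obtain ⟨_, c', hc', hcard', hcls⟩ := hG
  obtain rfl : c = c' := by
    have := Nat.pow_right_injective hp.two_le (hcard.symm.trans hcard')
    omega
  have hQc := Group.nilpotencyClass_quotient_center (G := G)
  rw [hcls] at hQc
  have hQ := pow_nilpotencyClass_succ_le_card (hPG.to_quotient (center G)) (by omega)
  rw [hQc, Nat.sub_add_cancel (by omega)] at hQ
  obtain ⟨k, hk, hk'⟩ := IsPGroup.card_center_eq_prime_pow hcard (by omega)
  have hmul := (center G).card_mul_index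
  have hZ : p ≤ Nat.card (center G) := hk' ▸ Nat.le_self_pow hk.ne' p
  change Nat.card (center G) * Nat.card (G ⧸ center G) = _ at hmul
  rw [hcard, pow_succ'] at hmul
  have hpc : 0 < p ^ c := pow_pos hp.pos c
  have hZ' : Nat.card (center G) = p := by
    refine le_antisymm (Nat.le_of_mul_le_mul_right (hmul ▸ Nat.mul_le_mul_left _ hQ) hpc) hZ
  have hQ' : Nat.card (G ⧸ center G) = p ^ c := by
    rw [hZ'] at hmul
    exact Nat.eq_of_mul_eq_mul_left hp.pos hmul
  refine ⟨hZ', hQ', hp, c - 1, by omega, ?_, hQc⟩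
  rw [hQ', Nat.sub_add_cancel (by omega)]

theorem finrank_ne_one {V : Type*} [AddCommGroup V] [Module ℂ V] (hG : IsMaximalClass p G)
    (ρ : Representation ℂ G V) (hker : MonoidHom.ker ρ = ⊥) : finrank ℂ V ≠ 1 := by
  intro h1
  refine hG.not_isMulCommutative ⟨⟨fun a b => (MonoidHom.ker_eq_bot_iff ρ).mp hker ?_⟩⟩
  obtain ⟨v, _, hv⟩ := finrank_eq_one_iff'.mp h1
  rw [map_mul, map_mul]
  refine LinearMap.ext fun w => ?_
  obtain ⟨a', ha⟩ := hv (ρ a v)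
  obtain ⟨b', hb⟩ := hv (ρ b v)
  obtain ⟨c, rfl⟩ := hv w
  simp only [map_smul, End.mul_apply, ← ha, ← hb]
  rw [smul_comm a' b']

theorem pow_four_mem_codegrees_of_card (hG : IsMaximalClass p G) (hcard : Nat.card G = p ^ 6) :
    (p : ℂ) ^ 4 ∈ codegrees G := by
  have hp := hG.1
  have := Fact.mk hp
  have hPG := hG.isPGroup
  have hp0 : (p : ℂ) ≠ 0 := Nat.cast_ne_zero.mpr hp.ne_zero
  obtain ⟨hZ, hQcard, hQ⟩ := hG.card_center_and_card_quotient (c := 5) (by norm_num) hcard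
  obtain ⟨n, ρ, hρ, hker⟩ := exists_faithful_irreducible hPG hZ
  obtain ⟨T, v, hv, hTv, hT⟩ := exists_common_eigenvector_finrank_eq_index hPG ρ hρ
  obtain ⟨k, hk⟩ := hPG.index T
  have hcod := card_div_finrank_mem_codegrees ρ hρ hker
  have hdim : finrank ℂ (Fin n → ℂ) = p ^ k := hT.trans hk
  have hk1 : k ≠ 0 := by
    rintro rfl
    exact hG.finrank_ne_one ρ hker (by rw [hdim, pow_zero])
  have hk2 : k ≤ 2 := by
    have hnt : Nontrivial (center G) := by
      rw [← Finite.one_lt_card_iff_nontrivial, hZ]; exact hp.one_lt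
    obtain ⟨⟨z, hz⟩, hz1⟩ := exists_ne (1 : center G)
    have h := finrank_sq_lt_card ρ hρ z (fun h => hz1 (Subtype.ext h)) hz
    rw [hdim, hcard, ← pow_mul] at h
    have := (Nat.pow_lt_pow_iff_right hp.one_lt).mp h
    omega
  obtain rfl | rfl : k = 1 ∨ k = 2 := by omega
  · rw [pow_one] at hk
    -- A subgroup whose index is the smallest prime factor of the order is normal.
    have hTn : T.Normal := normal_of_index_eq_minFac_card (by
      rw [hk, hcard, Nat.Prime.pow_minFac hp (by norm_num)])
    have hTc : IsMulCommutative T := ⟨⟨fun a b => Subtype.ext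
      (commute_of_normal_of_common_eigenvector ρ hρ hker T v hv hTv a.2 b.2)⟩⟩
    refine codegrees_subset_of_surjective (QuotientGroup.mk' (center G))
      (QuotientGroup.mk'_surjective _) ?_
    have hQP := hQ.isPGroup
    obtain ⟨hQZ, -, -⟩ := hQ.card_center_and_card_quotient (c := 4) (by norm_num) hQcard
    obtain ⟨m, σ, hσ, hσker⟩ := exists_faithful_irreducible hQP hQZ
    obtain ⟨S, -, -, -, hS⟩ := exists_common_eigenvector_finrank_eq_index hQP σ hσ
    obtain ⟨j, hj⟩ := hQP.index S
    have hj0 : j ≠ 0 := by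
      rintro rfl
      exact hQ.finrank_ne_one σ hσker (by rw [hS, hj, pow_zero])
    -- The image of `T` is abelian of index dividing `p`, which bounds the degree of `σ`.
    have hj1 : p ^ j ≤ p ^ 1 := by
      rw [← hj, ← hS, pow_one]
      refine (finrank_le_index_of_isMulCommutative σ hσ
        (T.map (QuotientGroup.mk' (center G)))).trans (Nat.le_of_dvd hp.pos ?_)
      exact hk ▸ T.index_map_dvd (QuotientGroup.mk'_surjective _)
    obtain rfl : j = 1 := by
      have := (Nat.pow_le_pow_iff_right hp.one_lt).mp hj1
      omega
    have h := card_div_finrank_mem_codegrees σ hσ hσker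
    rw [hS, hj, hQcard] at h
    convert h using 1
    push_cast
    field_simp
  · rw [hdim, hcard] at hcod
    convert hcod using 1
    push_cast
    field_simp

end IsMaximalClass

end MaximalClass

theorem mainTheorem6 (p : ℕ) (G : Type*) [Group G] [Finite G]
    (hG : IsMaximalClass p G) (hcard : p ^ 6 ≤ Nat.card G) :
    (p : ℂ) ^ 4 ∈ codegrees G := by
  have hp := hG.1
  obtain ⟨c, hc⟩ : ∃ c, Nat.card G = p ^ (c + 1) := let ⟨_, c, _, h, _⟩ := hG; ⟨c, h⟩
  have h5 : 5 ≤ c := by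
    rw [hc] at hcard
    have := (Nat.pow_le_pow_iff_right hp.one_lt).mp hcard
    omega
  clear hcard
  -- The order is `p ^ (c + 1)`, so the base case `c = 5` is order `p ^ 6`.
  induction c, h5 using Nat.le_induction generalizing G with
  | base => exact hG.pow_four_mem_codegrees_of_card hc
  | succ c h5 ih =>
    obtain ⟨-, hQcard, hQ⟩ := hG.card_center_and_card_quotient (by omega) hc
    exact codegrees_subset_of_surjective (QuotientGroup.mk' (center G))
      (QuotientGroup.mk'_surjective _) (ih (G ⧸ center G) hQ hQcard)
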